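/- Let $n\ge 0$ be an integer. We say that $u:\mathbb R^n\to\mathbb R$ satisfies the standing assumption (A) if $u\in C^2(\mathbb R^n)\cap L^\infty(\mathbb R^n)$, $\nabla u$ is globally Hölder continuous on $\mathbb R^n$ with some exponent $\alpha\in(0,1)$, and $|\nabla u|$ is bounded on $\mathbb R^n$. Let $P=P(s,p)$ be a function on $\mathbb R\times\mathbb R^n$ and $m:\mathbb R^n\to[0,\infty)$. We say that $P$ is a $P$-function along an entire solution $u$, with weight $m$, if $x\mapsto P(u(x),\nabla u(x))$ is $C^2$ near every point where $m>0$ and there is a linear operator $$L=-\sum_{i,j=1}^n a_{ij}(x)\,\partial_{x_i x_j}+\sum_{i=1}^n b_i(x)\,\partial_{x_i}+c(x),\qquad c\ge 0,$$ which is elliptic wherever $m>0$ and uniformly elliptic where the gradient is bounded away from zero, such that $m(x)\,L\big[P(u,\nabla u)\big](x)\le 0$ for all $x\in\mathbb R^n$. Here elliptic at $x$ means $\sum_{i,j} a_{ij}(x)\xi_i\xi_j>0$ for all $\xi\neq 0$, and uniformly elliptic where the gradient is bounded away from zero means: for every $\varepsilon>0$ there is $K$ such that at every $x$ with $|\nabla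 u(x)|\ge\varepsilon$ there is $\lambda>0$ with $\lambda|\xi|^2\le\sum_{i,j} a_{ij}(x)\xi_i\xi_j\le K\lambda|\xi|^2$ for all $\xi\in\mathbb R^n$ and $|b(x)|\le K\lambda$. **Theorem.** 1. Let $F$ be continuous and let $u$ be an entire solution of $F(u,\nabla u,\nabla^2u)=0$ in $\mathbb R^n$ that satisfies (A). Suppose that $P(u,\nabla u)=g(\nabla u)$ is a $P$-function along $u$ with weight $m(x)=\mu(|\nabla u(x)|)$, where $\mu(t)>0$ for all $t>0$, and where $g:\mathbb R^n\to[0,\infty)$ is continuous with $\{p\in\mathbb R^n: g(p)=0\}=\{0\}$. Then $u$ is constant. 2. Let $f:\mathbb R\to\mathbb R$ be differentiable and let $u$ satisfy (A) and $\Delta u=f(u)$ in $\mathbb R^n$, with $f'(u(x))\ge 0$ for all $x\in\mathbb R^n$. Then $u$ is constant. 3. Let $G:\mathbb R\to\mathbb R$ be continuous with $G(0)\neq 0$. Then there is no $u$ that satisfies (A) and $\Delta u=G(|\nabla u|^2)$ in $\mathbb R^n$. -/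

import Mathlib

open scoped NNReal Gradient Laplacian

noncomputable section

/-- `ℝⁿ` with its Euclidean norm. -/
abbrev RSpace (n : ℕ) : Type := EuclideanSpace ℝ (Fin n)

/-- The partial derivative `∂w/∂xᵢ` at `x`. -/
def partialD {n : ℕ} (i : Fin n) (w : RSpace n → ℝ) (x : RSpace n) : ℝ :=
  fderiv ℝ w x (EuclideanSpace.single i 1)

/-- The Hessian matrix `(∂²w/∂xᵢ∂xⱼ)` at `x`. -/
def hessianMatrix {n : ℕ} (w : RSpace n → ℝ) (x : RSpace n) : Matrix (Fin n) (Fin n) ℝ :=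
  Matrix.of fun i j => partialD i (partialD j w) x

/-- `u` is an entire (classical) solution of `F(u, ∇u, ∇²u) = 0`. -/
def IsEntireSolution {n : ℕ} (F : ℝ × RSpace n × Matrix (Fin n) (Fin n) ℝ → ℝ)
    (u : RSpace n → ℝ) : Prop :=
  ContDiff ℝ 2 u ∧ ∀ x, F (u x, ∇ u x, hessianMatrix u x) = 0

/-- The standing assumption on entire solutions: `u ∈ C²(ℝⁿ) ∩ L^∞(ℝⁿ)`,
`∇u ∈ C^α(ℝⁿ; ℝⁿ)` for some `α ∈ (0,1)`, and `|∇u|` is bounded. -/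
structure StandingAssumption {n : ℕ} (u : RSpace n → ℝ) : Prop where
  contDiff : ContDiff ℝ 2 u
  bounded : ∃ M : ℝ, ∀ x, |u x| ≤ M
  holder_gradient : ∃ α : ℝ≥0, 0 < α ∧ α < 1 ∧ ∃ K : ℝ≥0, HolderWith K α (∇ u)
  bounded_gradient : ∃ C : ℝ, 0 < C ∧ ∀ x, ‖∇ u x‖ ≤ C

/-- The coefficients of a second order linear operator
`L = - ∑ aᵢⱼ ∂ᵢ∂ⱼ + ∑ bᵢ ∂ᵢ + c` on `ℝⁿ`; they may depend on the point. -/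
structure LinearOperator2 (n : ℕ) where
  a : RSpace n → Matrix (Fin n) (Fin n) ℝ
  b : RSpace n → RSpace n
  c : RSpace n → ℝ

namespace LinearOperator2

variable {n : ℕ}

/-- `(L w)(x)`. -/
def apply (L : LinearOperator2 n) (w : RSpace n → ℝ) (x : RSpace n) : ℝ :=
  -(∑ i, ∑ j, L.a x i j * hessianMatrix w x i j) + (∑ i, L.b x i * partialD i w x) + L.c x * w x

/-- The quadratic form `∑ aᵢⱼ(x) ξᵢ ξⱼ` of the principal part. -/
def principalForm (L : LinearOperator2 n) (x ξ : RSpace n) : ℝ :=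
  ∑ i, ∑ j, L.a x i j * ξ i * ξ j

/-- `L` is elliptic at `x`. -/
def IsEllipticAt (L : LinearOperator2 n) (x : RSpace n) : Prop :=
  ∀ ξ : RSpace n, ξ ≠ 0 → 0 < L.principalForm x ξ

/-- `L` is uniformly elliptic on `S`, with first order coefficients controlled by the ellipticity:
with `lam` the local lower ellipticity constant, `Λ / lam` and `|b| / lam` are bounded on `S`. -/
def IsUniformlyEllipticOn (L : LinearOperator2 n) (S : Set (RSpace n)) : Prop :=
  ∃ K : ℝ, ∀ x ∈ S, ∃ lam : ℝ, 0 < lam ∧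
    (∀ ξ : RSpace n, lam * ‖ξ‖ ^ 2 ≤ L.principalForm x ξ ∧
      L.principalForm x ξ ≤ K * lam * ‖ξ‖ ^ 2) ∧
    ‖L.b x‖ ≤ K * lam

end LinearOperator2

/-- `P = P(u, ∇u)` is a `P`-function along the solution `u`, with weight `m = m(x) ≥ 0`: there is an
elliptic operator `L` with zeroth order coefficient `c ≥ 0` such that `m · L P(u, ∇u) ≤ 0` in `ℝⁿ`.
Where `m = 0` the inequality is void, so smoothness of `P(u, ∇u)` and ellipticity are asked only
where `m > 0`. Ellipticity is uniform on every set on which `|∇u|` is bounded away from `0`. -/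
def IsPFunction {n : ℕ} (u : RSpace n → ℝ) (P : ℝ → RSpace n → ℝ) (m : RSpace n → ℝ) : Prop :=
  (∀ x, 0 ≤ m x) ∧
  (∀ x, 0 < m x → ContDiffAt ℝ 2 (fun y => P (u y) (∇ u y)) x) ∧
  ∃ L : LinearOperator2 n,
    (∀ x, 0 ≤ L.c x) ∧
    (∀ x, 0 < m x → L.IsEllipticAt x) ∧
    (∀ ε : ℝ, 0 < ε → L.IsUniformlyEllipticOn {x | ε ≤ ‖∇ u x‖}) ∧
    ∀ x, m x * L.apply (fun y => P (u y) (∇ u y)) x ≤ 0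

end

/-!
Let `w` be either `P(u, ∇u)` or a difference of translates `u(· + e) - u`, let `S > 0` be its
supremum, and suppose that `w` is a subsolution of an operator that is uniformly elliptic where `w`
is close to `S`. If `w ≤ S - η` at a point `y`, then by uniform continuity `w` stays below `S` by a
fixed amount near `y`, and comparison with a Gaussian centred at `y` shows that at distance at most
`R` from `y` it stays below `S` by an amount depending only on `η` and `R`. Hence points where `w`
is almost `S` are centres of balls, as large as we please, on which `w` is almost `S`.

Touching the bounded function `u` from below by flat paraboloids yields, in every ball of a large
radius independent of its centre, a point where `|∇u|` is small and `Δu` is almost nonnegative. For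
the `P`-function this contradicts `w ≈ S` on a large ball, since `P(u, ∇u)` is at most small where
`∇u` is. For the translates, `w ≥ S / 2` on a large ball makes `u` grow linearly along `e`, which
contradicts boundedness. For `Δu = G(|∇u|²)` the touching points give `G 0 ≥ 0`, and applied to
`-u` they give `G 0 ≤ 0`.
-/

open Filter Topology Set Metric

theorem exists_isLocalMax_of_annulus {X : Type*} [PseudoMetricSpace X] [ProperSpace X] {v : X → ℝ}
    (hv : Continuous v) {x y : X} {r s : ℝ} (hx : dist x y ≤ s)
    (hinner : ∀ z, dist z y ≤ r → v z < v x) (houter : ∀ z, dist z y = s → v z < v x) :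
    ∃ z, r < dist z y ∧ dist z y < s ∧ v x ≤ v z ∧ IsLocalMax v z := by
  obtain ⟨z, ⟨hrz, hzs⟩, hmax⟩ : ∃ z ∈ {z | r < dist z y ∧ dist z y < s},
      IsMaxOn v (closedBall y s) z := by
    refine (isCompact_closedBall y s).exists_isMaxOn_mem_subset hv.continuousOn
      (mem_closedBall.2 hx) fun z ⟨hzs, hz⟩ => ?_
    rcases le_or_gt (dist z y) r with hzr | hrz
    · exact hinner z hzr
    · exact houter z (hzs.antisymm (not_lt.1 fun h => hz ⟨hrz, h⟩))
  exact ⟨z, hrz, hzs, hmax (mem_closedBall.2 hx),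
    hmax.isLocalMax (closedBall_mem_nhds_of_mem (mem_ball.2 hzs))⟩

section SecondOrderCalculus

theorem deriv_deriv_nonpos_of_isLocalMax {f : ℝ → ℝ} {a : ℝ} (h : IsLocalMax f a)
    (hf : ContinuousAt f a) : deriv (deriv f) a ≤ 0 := by
  by_contra! hpos
  have hmin : IsLocalMin f a := isLocalMin_of_deriv_deriv_pos hpos h.deriv_eq_zero hf
  have hconst : f =ᶠ[𝓝 a] fun _ => f a := by
    filter_upwards [hmin, h] with t h₁ h₂ using le_antisymm h₂ h₁
  have hzero : deriv f =ᶠ[𝓝 a] fun _ => 0 := by simpa using hconst.deriv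
  exact hpos.ne' (by simp [hzero.deriv_eq])

variable {E : Type*} [NormedAddCommGroup E] [NormedSpace ℝ E]

theorem differentiableAt_fderiv_of_contDiffAt {w : E → ℝ} {x : E} (hw : ContDiffAt ℝ 2 w x) :
    DifferentiableAt ℝ (fderiv ℝ w) x :=
  (hw.fderiv_right (m := 1) (by norm_num)).differentiableAt (by simp)

theorem deriv_deriv_comp_add_smul {w : E → ℝ} {x : E} (hw : ContDiffAt ℝ 2 w x) (ξ : E) :
    deriv (deriv fun t : ℝ => w (x + t • ξ)) 0 = fderiv ℝ (fderiv ℝ w) x ξ ξ := by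
  have hline (t : ℝ) : HasDerivAt (fun t : ℝ => x + t • ξ) ξ t := by
    simpa using ((hasDerivAt_id t).smul_const ξ).const_add x
  have htendsto : Tendsto (fun t : ℝ => x + t • ξ) (𝓝 0) (𝓝 x) := by
    simpa using (hline 0).continuousAt.tendsto
  have hdiff : ∀ᶠ y in 𝓝 x, DifferentiableAt ℝ w y := by
    filter_upwards [hw.eventually (by simp)] with y hy using hy.differentiableAt (by simp)
  have hfirst : deriv (fun t : ℝ => w (x + t • ξ)) =ᶠ[𝓝 0] fun t => fderiv ℝ w (x + t • ξ) ξ := by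
    filter_upwards [htendsto.eventually hdiff] with t ht
    exact (ht.hasFDerivAt.comp_hasDerivAt t (hline t)).deriv
  have hfderiv : HasFDerivAt (fderiv ℝ w) (fderiv ℝ (fderiv ℝ w) x) (x + (0 : ℝ) • ξ) := by
    simpa using (differentiableAt_fderiv_of_contDiffAt hw).hasFDerivAt
  have hsecond := hfderiv.comp_hasDerivAt (0 : ℝ) (hline 0)
  have hsecond_apply := hsecond.clm_apply (hasDerivAt_const (0 : ℝ) ξ)
  rw [hfirst.deriv_eq]
  simpa using hsecond_apply.deriv

theorem fderiv_fderiv_nonpos_of_isLocalMax {w : E → ℝ} {x : E} (h : IsLocalMax w x)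
    (hw : ContDiffAt ℝ 2 w x) (ξ : E) : fderiv ℝ (fderiv ℝ w) x ξ ξ ≤ 0 := by
  have hline : ContinuousAt (fun t : ℝ => x + t • ξ) 0 := by fun_prop
  rw [← deriv_deriv_comp_add_smul hw]
  refine deriv_deriv_nonpos_of_isLocalMax ?_ ?_
  · have hx : IsLocalMax w (x + (0 : ℝ) • ξ) := by simpa using h
    exact hline.tendsto.eventually hx
  · exact ContinuousAt.comp (g := w) (by simpa using hw.continuousAt) hline

end SecondOrderCalculus

section GaussianBarrier

variable {E : Type*} [NormedAddCommGroup E]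

/-- The Gaussian `exp (-κ |x - c|²)`, which serves as a barrier in the maximum principle. -/
noncomputable def gaussianBarrier (κ : ℝ) (c x : E) : ℝ := Real.exp (-κ * ‖x - c‖ ^ 2)

theorem gaussianBarrier_pos (κ : ℝ) (c x : E) : 0 < gaussianBarrier κ c x := Real.exp_pos _

theorem gaussianBarrier_le_one {κ : ℝ} (hκ : 0 ≤ κ) (c x : E) : gaussianBarrier κ c x ≤ 1 :=
  Real.exp_le_one_iff.2 (by nlinarith [mul_nonneg hκ (sq_nonneg ‖x - c‖)])

end GaussianBarrier

section InnerProductSpace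

variable {E : Type*} [NormedAddCommGroup E] [InnerProductSpace ℝ E]

theorem hasFDerivAt_const_mul_norm_sub_sq (κ : ℝ) (c x : E) :
    HasFDerivAt (fun y => κ * ‖y - c‖ ^ 2) ((2 * κ) • innerSL ℝ (x - c)) x := by
  refine (((hasFDerivAt_id x).sub_const c).norm_sq.const_mul κ).congr_fderiv ?_
  ext y
  simp
  ring

theorem contDiff_const_mul_norm_sub_sq (κ : ℝ) (c : E) {m : WithTop ℕ∞} :
    ContDiff ℝ m fun y => κ * ‖y - c‖ ^ 2 :=
  contDiff_const.mul ((contDiff_id.sub contDiff_const).norm_sq ℝ)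

theorem hasFDerivAt_innerSL_sub (c x : E) :
    HasFDerivAt (fun y => innerSL ℝ (y - c)) (innerSL ℝ (E := E)) x :=
  (innerSL ℝ (E := E)).hasFDerivAt.comp x ((hasFDerivAt_id x).sub_const c)

theorem fderiv_fderiv_const_mul_norm_sub_sq (κ : ℝ) (c x ξ ζ : E) :
    fderiv ℝ (fderiv ℝ fun y => κ * ‖y - c‖ ^ 2) x ξ ζ = 2 * κ * inner ℝ ξ ζ := by
  have hsecond : HasFDerivAt (fun y => (2 * κ) • innerSL ℝ (y - c)) _ x :=
    (hasFDerivAt_innerSL_sub c x).const_smul (2 * κ)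
  rw [funext fun y => (hasFDerivAt_const_mul_norm_sub_sq κ c y).fderiv, hsecond.fderiv]
  rfl

theorem contDiff_gaussianBarrier (κ : ℝ) (c : E) {m : WithTop ℕ∞} :
    ContDiff ℝ m (gaussianBarrier κ c) :=
  (contDiff_const_mul_norm_sub_sq (-κ) c).exp

theorem hasFDerivAt_gaussianBarrier (κ : ℝ) (c x : E) :
    HasFDerivAt (gaussianBarrier κ c)
      (gaussianBarrier κ c x • (2 * -κ) • innerSL ℝ (x - c)) x :=
  (hasFDerivAt_const_mul_norm_sub_sq (-κ) c x).exp

theorem fderiv_fderiv_gaussianBarrier (κ : ℝ) (c x ξ ζ : E) :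
    fderiv ℝ (fderiv ℝ (gaussianBarrier κ c)) x ξ ζ =
      2 * κ * gaussianBarrier κ c x *
        (2 * κ * (inner ℝ (x - c) ξ * inner ℝ (x - c) ζ) - inner ℝ ξ ζ) := by
  have hsecond : HasFDerivAt (fun y => gaussianBarrier κ c y • (2 * -κ) • innerSL ℝ (y - c)) _ x :=
    (hasFDerivAt_gaussianBarrier κ c x).smul ((hasFDerivAt_innerSL_sub c x).const_smul (2 * -κ))
  rw [funext fun y => (hasFDerivAt_gaussianBarrier κ c y).fderiv, hsecond.fderiv]
  have hinner : (innerSL ℝ : E →L[ℝ] E →L[ℝ] ℝ) ξ ζ = inner ℝ ξ ζ := rfl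
  simp [hinner, inner_sub_left]
  ring

section Laplacian

variable [FiniteDimensional ℝ E]

theorem laplacian_eq_sum_fderiv_fderiv {ι : Type*} [Fintype ι] (e : OrthonormalBasis ι ℝ E)
    (w : E → ℝ) (x : E) : Δ w x = ∑ i, fderiv ℝ (fderiv ℝ w) x (e i) (e i) := by
  simp [InnerProductSpace.laplacian_eq_iteratedFDeriv_orthonormalBasis w e,
    iteratedFDeriv_two_apply]

theorem laplacian_nonpos_of_isLocalMax {w : E → ℝ} {x : E} (h : IsLocalMax w x)
    (hw : ContDiffAt ℝ 2 w x) : Δ w x ≤ 0 := by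
  rw [laplacian_eq_sum_fderiv_fderiv (stdOrthonormalBasis ℝ E)]
  exact Finset.sum_nonpos fun i _ => fderiv_fderiv_nonpos_of_isLocalMax h hw _

theorem laplacian_nonneg_of_isLocalMin {w : E → ℝ} {x : E} (h : IsLocalMin w x)
    (hw : ContDiffAt ℝ 2 w x) : 0 ≤ Δ w x := by
  have hneg := laplacian_nonpos_of_isLocalMax (w := -w) h.neg hw.neg
  rw [InnerProductSpace.laplacian_neg, Pi.neg_apply] at hneg
  linarith

theorem laplacian_const_mul_norm_sub_sq (κ : ℝ) (c x : E) :
    Δ (fun y => κ * ‖y - c‖ ^ 2) x = 2 * κ * Module.finrank ℝ E := by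
  simp [laplacian_eq_sum_fderiv_fderiv (stdOrthonormalBasis ℝ E),
    fderiv_fderiv_const_mul_norm_sub_sq, mul_comm]

theorem laplacian_comp_add_right (u : E → ℝ) (h x : E) :
    Δ (fun y => u (y + h)) x = Δ u (x + h) := by
  simp [InnerProductSpace.laplacian_eq_iteratedFDeriv_stdOrthonormalBasis,
    iteratedFDeriv_comp_add_right]

end Laplacian

end InnerProductSpace

section Hessian

open scoped Matrix

theorem sum_sum_mul_nonneg_of_posSemidef {ι : Type*} [Fintype ι] {A N : Matrix ι ι ℝ}
    (hA : ∀ ξ : ι → ℝ, 0 ≤ ξ ⬝ᵥ A *ᵥ ξ) (hN : N.PosSemidef) : 0 ≤ ∑ i, ∑ j, A i j * N i j := by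
  have hA_symm : (A + Aᵀ).PosSemidef := by
    refine .of_dotProduct_mulVec_nonneg (by ext i j; simp [add_comm]) fun ξ => ?_
    rw [star_trivial, Matrix.add_mulVec, dotProduct_add, Matrix.mulVec_transpose,
      dotProduct_comm ξ (ξ ᵥ* A), ← Matrix.dotProduct_mulVec]
    exact add_nonneg (hA ξ) (hA ξ)
  -- `A` need not be symmetric, but only its symmetric part pairs with `N`; by the Schur product
  -- theorem the sum of the entries of `(A + Aᵀ) ⊙ N` is nonnegative.
  have hschur := (hA_symm.hadamard hN).dotProduct_mulVec_nonneg 1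
  have hswap : ∑ i, ∑ j, A j i * N i j = ∑ i, ∑ j, A i j * N i j := by
    rw [Finset.sum_comm]
    exact Finset.sum_congr rfl fun i _ => Finset.sum_congr rfl fun j _ => by
      rw [← hN.isHermitian.apply i j, star_trivial]
  simp only [dotProduct, Matrix.mulVec, star_one, Pi.one_apply, one_mul, mul_one,
    Matrix.hadamard_apply, Matrix.add_apply, Matrix.transpose_apply, add_mul,
    Finset.sum_add_distrib, hswap] at hschur
  linarith

variable {n : ℕ} {v w : RSpace n → ℝ} {x : RSpace n}

theorem hessianMatrix_apply (hw : ContDiffAt ℝ 2 w x) (i j : Fin n) :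
    hessianMatrix w x i j =
      fderiv ℝ (fderiv ℝ w) x (EuclideanSpace.single i 1) (EuclideanSpace.single j 1) := by
  have hpartial : HasFDerivAt (partialD j w) _ x :=
    (differentiableAt_fderiv_of_contDiffAt hw).hasFDerivAt.clm_apply
      (hasFDerivAt_const (EuclideanSpace.single j 1) x)
  rw [hessianMatrix, Matrix.of_apply, partialD, hpartial.fderiv]
  simp

theorem hessianMatrix_add (hv : ContDiffAt ℝ 2 v x) (hw : ContDiffAt ℝ 2 w x) :
    hessianMatrix (v + w) x = hessianMatrix v x + hessianMatrix w x := by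
  have hfderiv : fderiv ℝ (v + w) =ᶠ[𝓝 x] fderiv ℝ v + fderiv ℝ w := by
    filter_upwards [hv.eventually (by simp), hw.eventually (by simp)] with y hvy hwy
    exact fderiv_add (hvy.differentiableAt (by simp)) (hwy.differentiableAt (by simp))
  have hvw : ContDiffAt ℝ 2 (v + w) x := hv.add hw
  ext i j
  rw [Matrix.add_apply, hessianMatrix_apply hv, hessianMatrix_apply hw,
    hessianMatrix_apply hvw, hfderiv.fderiv_eq,
    fderiv_add (differentiableAt_fderiv_of_contDiffAt hv)
      (differentiableAt_fderiv_of_contDiffAt hw)]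
  simp

theorem partialD_const_smul (k : ℝ) (w : RSpace n → ℝ) (i : Fin n) :
    partialD i (k • w) = k • partialD i w := by
  ext y
  simp [partialD, fderiv_const_smul_field]

theorem hessianMatrix_const_smul (k : ℝ) (w : RSpace n → ℝ) (x : RSpace n) :
    hessianMatrix (k • w) x = k • hessianMatrix w x := by
  ext i j
  simp [hessianMatrix, partialD_const_smul]

theorem dotProduct_hessianMatrix_mulVec (hw : ContDiffAt ℝ 2 w x) (ξ : RSpace n) :
    ξ ⬝ᵥ hessianMatrix w x *ᵥ ξ = fderiv ℝ (fderiv ℝ w) x ξ ξ := by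
  have hξ : ξ = ∑ i, ξ i • EuclideanSpace.single i (1 : ℝ) := by
    ext j
    simp [Finset.sum_apply, Pi.single_apply]
  conv_rhs => rw [hξ]
  simp only [dotProduct, Matrix.mulVec, hessianMatrix_apply hw, Finset.mul_sum, map_sum, map_smul,
    sum_apply, smul_apply, smul_eq_mul]
  rw [Finset.sum_comm]
  exact Finset.sum_congr rfl fun i _ => Finset.sum_congr rfl fun j _ => by ring

theorem posSemidef_neg_hessianMatrix_of_isLocalMax (h : IsLocalMax w x)
    (hw : ContDiffAt ℝ 2 w x) : (-hessianMatrix w x).PosSemidef := by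
  refine .of_dotProduct_mulVec_nonneg ?_ fun ξ => ?_
  · ext i j
    simpa [hessianMatrix_apply hw] using (hw.isSymmSndFDerivAt (by simp)).eq _ _
  · rw [star_trivial, Matrix.neg_mulVec, dotProduct_neg, neg_nonneg]
    exact (dotProduct_hessianMatrix_mulVec hw (WithLp.toLp 2 ξ)).trans_le
      (fderiv_fderiv_nonpos_of_isLocalMax h hw _)

theorem laplacian_eq_sum_hessianMatrix (hw : ContDiffAt ℝ 2 w x) :
    Δ w x = ∑ i, hessianMatrix w x i i := by
  simp [laplacian_eq_sum_fderiv_fderiv (EuclideanSpace.basisFun (Fin n) ℝ), hessianMatrix_apply hw]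

theorem partialD_gaussianBarrier (κ : ℝ) (c x : RSpace n) (i : Fin n) :
    partialD i (gaussianBarrier κ c) x = -(2 * κ * gaussianBarrier κ c x * (x - c) i) := by
  rw [partialD, (hasFDerivAt_gaussianBarrier κ c x).fderiv]
  simp [EuclideanSpace.inner_single_right]
  ring

theorem hessianMatrix_gaussianBarrier (κ : ℝ) (c x : RSpace n) (i j : Fin n) :
    hessianMatrix (gaussianBarrier κ c) x i j =
      2 * κ * gaussianBarrier κ c x *
        (2 * κ * ((x - c) i * (x - c) j) - (1 : Matrix (Fin n) (Fin n) ℝ) i j) := by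
  rw [hessianMatrix_apply (contDiff_gaussianBarrier κ c).contDiffAt, fderiv_fderiv_gaussianBarrier]
  simp [EuclideanSpace.inner_single_right, Matrix.one_apply, eq_comm]

end Hessian

namespace LinearOperator2

variable {n : ℕ} {L : LinearOperator2 n} {v w : RSpace n → ℝ} {x : RSpace n}

/-- The generator `∑ aᵢⱼ ∂ᵢ∂ⱼ - ∑ bᵢ ∂ᵢ` of the diffusion attached to `L`, that is, `-L` without its
zeroth order term. The maximum principle is applied to it. -/
noncomputable def generator (L : LinearOperator2 n) (w : RSpace n → ℝ) (x : RSpace n) : ℝ :=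
  ∑ i, ∑ j, L.a x i j * hessianMatrix w x i j - ∑ i, L.b x i * partialD i w x

theorem apply_eq (L : LinearOperator2 n) (w : RSpace n → ℝ) (x : RSpace n) :
    L.apply w x = -L.generator w x + L.c x * w x := by
  rw [apply, generator]
  ring

theorem generator_nonneg (hc : 0 ≤ L.c x) (hw : 0 ≤ w x) (h : L.apply w x ≤ 0) :
    0 ≤ L.generator w x := by
  rw [apply_eq] at h
  linarith [mul_nonneg hc hw]

theorem generator_add (hv : ContDiffAt ℝ 2 v x) (hw : ContDiffAt ℝ 2 w x) :
    L.generator (v + w) x = L.generator v x + L.generator w x := by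
  have hpartial (i : Fin n) : partialD i (v + w) x = partialD i v x + partialD i w x := by
    simp [partialD, fderiv_add (hv.differentiableAt (by simp)) (hw.differentiableAt (by simp))]
  simp only [generator, hessianMatrix_add hv hw, hpartial, Matrix.add_apply, mul_add,
    Finset.sum_add_distrib]
  ring

theorem generator_const_smul (L : LinearOperator2 n) (k : ℝ) (w : RSpace n → ℝ) (x : RSpace n) :
    L.generator (k • w) x = k * L.generator w x := by
  simp only [generator, hessianMatrix_const_smul, partialD_const_smul, Matrix.smul_apply,
    Pi.smul_apply, smul_eq_mul, mul_left_comm _ k, ← Finset.mul_sum, mul_sub]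

open scoped Matrix in
theorem principalForm_eq_dotProduct (L : LinearOperator2 n) (x ξ : RSpace n) :
    L.principalForm x ξ = ξ ⬝ᵥ L.a x *ᵥ ξ := by
  simp only [principalForm, dotProduct, Matrix.mulVec, Finset.mul_sum]
  exact Finset.sum_congr rfl fun i _ => Finset.sum_congr rfl fun j _ => by ring

theorem generator_nonpos_of_isLocalMax (hL : ∀ ξ, 0 ≤ L.principalForm x ξ) (h : IsLocalMax w x)
    (hw : ContDiffAt ℝ 2 w x) : L.generator w x ≤ 0 := by
  have hsum := sum_sum_mul_nonneg_of_posSemidef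
    (fun ξ => (hL (WithLp.toLp 2 ξ)).trans_eq (L.principalForm_eq_dotProduct x _))
    (posSemidef_neg_hessianMatrix_of_isLocalMax h hw)
  simp only [Matrix.neg_apply, mul_neg, Finset.sum_neg_distrib] at hsum
  simp only [generator, partialD, h.fderiv_eq_zero, zero_apply, mul_zero, Finset.sum_const_zero]
  linarith

theorem generator_gaussianBarrier (L : LinearOperator2 n) (κ : ℝ) (c x : RSpace n) :
    L.generator (gaussianBarrier κ c) x =
      2 * κ * gaussianBarrier κ c x *
        (2 * κ * L.principalForm x (x - c) - (L.a x).trace + inner ℝ (L.b x) (x - c)) := by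
  have htrace : (L.a x).trace = ∑ i, ∑ j, L.a x i j * (1 : Matrix (Fin n) (Fin n) ℝ) i j := by
    simp [Matrix.trace, Matrix.one_apply]
  have hinner : inner ℝ (L.b x) (x - c) = ∑ i, L.b x i * (x - c) i := by
    simp [PiLp.inner_apply, mul_comm]
  simp only [generator, hessianMatrix_gaussianBarrier, partialD_gaussianBarrier, htrace, hinner,
    principalForm, Finset.mul_sum, ← Finset.sum_sub_distrib, ← Finset.sum_add_distrib]
  refine Finset.sum_congr rfl fun i _ => ?_
  rw [mul_add, Finset.mul_sum, sub_eq_add_neg]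
  congr 1
  · exact Finset.sum_congr rfl fun j _ => by ring
  · ring

theorem IsUniformlyEllipticOn.mono {S T : Set (RSpace n)} (hL : L.IsUniformlyEllipticOn T)
    (hST : S ⊆ T) : L.IsUniformlyEllipticOn S :=
  hL.imp fun _ hK x hx => hK x (hST hx)

theorem IsUniformlyEllipticOn.principalForm_nonneg {S : Set (RSpace n)}
    (hL : L.IsUniformlyEllipticOn S) (hx : x ∈ S) (ξ : RSpace n) : 0 ≤ L.principalForm x ξ := by
  obtain ⟨K, hK⟩ := hL
  obtain ⟨lam, hlam, hform, -⟩ := hK x hx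
  exact le_trans (by positivity) (hform ξ).1

theorem trace_le_of_principalForm_le {Λ : ℝ} (h : ∀ ξ, L.principalForm x ξ ≤ Λ * ‖ξ‖ ^ 2) :
    (L.a x).trace ≤ n * Λ := by
  have hdiag (i : Fin n) : L.a x i i ≤ Λ := by
    simpa [principalForm, Pi.single_apply] using h (EuclideanSpace.single i 1)
  simpa [Matrix.trace] using Finset.sum_le_sum fun i (_ : i ∈ Finset.univ) => hdiag i

theorem IsUniformlyEllipticOn.exists_generator_gaussianBarrier_pos {S : Set (RSpace n)}
    (hL : L.IsUniformlyEllipticOn S) {r : ℝ} (hr : 0 < r) (s : ℝ) :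
    ∃ κ > 0, ∀ c, ∀ x ∈ S, r ≤ ‖x - c‖ → ‖x - c‖ ≤ s →
      0 < L.generator (gaussianBarrier κ c) x := by
  obtain ⟨K, hK⟩ := hL
  obtain ⟨κ, hκ, hκK⟩ : ∃ κ > 0, K * (n + s) < 2 * κ * r ^ 2 := by
    refine ⟨|K * (n + s)| / r ^ 2 + 1, by positivity, ?_⟩
    field_simp
    nlinarith [le_abs_self (K * (n + s)), abs_nonneg (K * (n + s)), sq_pos_of_pos hr]
  refine ⟨κ, hκ, fun c x hx hrx hxs => ?_⟩
  obtain ⟨lam, hlam, hform, hb⟩ := hK x hx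
  have hlower : lam * r ^ 2 ≤ L.principalForm x (x - c) :=
    le_trans (by gcongr) (hform (x - c)).1
  have htrace : (L.a x).trace ≤ n * (K * lam) :=
    trace_le_of_principalForm_le fun ξ => (hform ξ).2
  have hdrift : |inner ℝ (L.b x) (x - c)| ≤ K * lam * s :=
    (abs_real_inner_le_norm _ _).trans <|
      mul_le_mul hb hxs (norm_nonneg _) ((norm_nonneg _).trans hb)
  rw [generator_gaussianBarrier]
  have hgauss := gaussianBarrier_pos κ c x
  refine mul_pos (by positivity) ?_
  nlinarith [mul_le_mul_of_nonneg_left hlower (by positivity : 0 ≤ 2 * κ),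
    mul_lt_mul_of_pos_left hκK hlam, neg_abs_le (inner ℝ (L.b x) (x - c))]

theorem le_sub_mul_gaussianBarrier_of_annulus {S θ ε κ r s : ℝ} {y : RSpace n}
    (hcont : Continuous w) (hS : ∀ x, w x ≤ S) (hε : 0 < ε) (hεθ : ε ≤ S - θ) (hκ : 0 ≤ κ)
    (hw : ∀ x, θ < w x → ContDiffAt ℝ 2 w x)
    (hL : ∀ x, θ < w x → ∀ ξ, 0 ≤ L.principalForm x ξ)
    (hsub : ∀ x, θ < w x → 0 ≤ L.generator w x)
    (hbarrier : ∀ x, θ < w x → r ≤ ‖x - y‖ → ‖x - y‖ ≤ s →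
      0 < L.generator (gaussianBarrier κ y) x)
    (hinner : ∀ x, ‖x - y‖ ≤ r → w x ≤ S - ε) {x : RSpace n} (hx : ‖x - y‖ ≤ s) :
    w x ≤ S - ε * (gaussianBarrier κ y x - Real.exp (-κ * s ^ 2)) := by
  set g := gaussianBarrier κ y
  set E := Real.exp (-κ * s ^ 2)
  have hE : 0 < E := Real.exp_pos _
  have hg : ContDiff ℝ 2 g := contDiff_gaussianBarrier κ y
  have hεg (z : RSpace n) : ε * g z ≤ ε :=
    mul_le_of_le_one_right hε.le (gaussianBarrier_le_one hκ y z)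
  by_contra! hlt
  have hvx : S + ε * E < (w + ε • g) x := by
    simp only [Pi.add_apply, Pi.smul_apply, smul_eq_mul]
    linarith
  obtain ⟨z, hrz, hzs, hvz, hmax⟩ : ∃ z, r < ‖z - y‖ ∧ ‖z - y‖ < s ∧
      (w + ε • g) x ≤ (w + ε • g) z ∧ IsLocalMax (w + ε • g) z := by
    simp only [← dist_eq_norm]
    refine exists_isLocalMax_of_annulus (hcont.add (hg.continuous.const_smul ε))
      ((dist_eq_norm x y).trans_le hx) (fun z hz => lt_of_le_of_lt ?_ hvx)
      (fun z hz => lt_of_le_of_lt ?_ hvx)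
    · simp only [Pi.add_apply, Pi.smul_apply, smul_eq_mul]
      linarith [hinner z ((dist_eq_norm z y).symm.trans_le hz), hεg z, mul_pos hε hE]
    · have hgz : g z = E := by simp only [g, E, gaussianBarrier, ← dist_eq_norm, hz]
      simpa [hgz] using hS z
  have hθz : θ < w z := by
    linarith [hεg z, mul_pos hε hE, show (w + ε • g) z = w z + ε * g z from rfl]
  have hεg_smooth : ContDiffAt ℝ 2 (ε • g) z := contDiffAt_const.smul hg.contDiffAt
  have hgen := generator_nonpos_of_isLocalMax (hL z hθz) hmax ((hw z hθz).add hεg_smooth)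
  rw [generator_add (hw z hθz) hεg_smooth, generator_const_smul] at hgen
  linarith [hsub z hθz, mul_pos hε (hbarrier z hθz hrz.le hzs.le)]

theorem IsUniformlyEllipticOn.exists_forall_dist_le_sub_lt {S θ : ℝ}
    (hL : L.IsUniformlyEllipticOn {x | θ < w x}) (hcont : UniformContinuous w)
    (hS : ∀ x, w x ≤ S) (hθ : θ < S) (hw : ∀ x, θ < w x → ContDiffAt ℝ 2 w x)
    (hsub : ∀ x, θ < w x → 0 ≤ L.generator w x) (R : ℝ) {η : ℝ} (hη : 0 < η) :
    ∃ δ > 0, ∀ x, S - δ < w x → ∀ y, dist x y ≤ R → S - η < w y := by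
  obtain ⟨r, hr, hosc⟩ := Metric.uniformContinuous_iff_le.1 hcont (η / 2) (half_pos hη)
  set ρ := max R r
  have hρ : 0 < ρ := hr.trans_le (le_max_right R r)
  obtain ⟨κ, hκ, hbarrier⟩ := hL.exists_generator_gaussianBarrier_pos hr (2 * ρ)
  set ε := min (η / 2) (S - θ)
  have hε : 0 < ε := lt_min (half_pos hη) (sub_pos.2 hθ)
  have hgap : Real.exp (-κ * (2 * ρ) ^ 2) < Real.exp (-κ * ρ ^ 2) :=
    Real.exp_lt_exp.2 (by nlinarith [mul_pos hκ (pow_pos hρ 2)])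
  refine ⟨ε * (Real.exp (-κ * ρ ^ 2) - Real.exp (-κ * (2 * ρ) ^ 2)),
    mul_pos hε (sub_pos.2 hgap), fun x hx y hxy => ?_⟩
  by_contra! hy
  have hxρ : ‖x - y‖ ≤ ρ := (dist_eq_norm x y).symm.trans_le (hxy.trans (le_max_left R r))
  have hinner (z : RSpace n) (hz : ‖z - y‖ ≤ r) : w z ≤ S - ε := by
    have hzy := hosc ((dist_eq_norm z y).trans_le hz)
    rw [Real.dist_eq] at hzy
    linarith [le_abs_self (w z - w y), min_le_left (η / 2) (S - θ)]
  have hwx := le_sub_mul_gaussianBarrier_of_annulus hcont.continuous hS hε (min_le_right _ _)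
    hκ.le hw (fun z hz => hL.principalForm_nonneg hz) hsub (fun z hz => hbarrier y z hz) hinner
    (hxρ.trans (by linarith))
  have hgauss : Real.exp (-κ * ρ ^ 2) ≤ gaussianBarrier κ y x :=
    Real.exp_le_exp.2 (by nlinarith [pow_le_pow_left₀ (norm_nonneg (x - y)) hxρ 2])
  linarith [mul_le_mul_of_nonneg_left hgauss hε.le]

theorem IsUniformlyEllipticOn.exists_forall_mem_closedBall_sub_lt {S θ : ℝ}
    (hL : L.IsUniformlyEllipticOn {x | θ < w x}) (hcont : UniformContinuous w)
    (hS : IsLUB (range w) S) (hθ : θ < S) (hw : ∀ x, θ < w x → ContDiffAt ℝ 2 w x)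
    (hsub : ∀ x, θ < w x → 0 ≤ L.generator w x) (R : ℝ) {η : ℝ} (hη : 0 < η) :
    ∃ x, ∀ y ∈ closedBall x R, S - η < w y := by
  obtain ⟨δ, hδ, h⟩ := hL.exists_forall_dist_le_sub_lt hcont (fun x => hS.1 (mem_range_self x))
    hθ hw hsub R hη
  obtain ⟨-, ⟨x, rfl⟩, hx, -⟩ := hS.exists_between (sub_lt_self S hδ)
  exact ⟨x, fun y hy => h x hx y (mem_closedBall'.1 hy)⟩

end LinearOperator2

section BoundedFunctions

variable {E : Type*} [NormedAddCommGroup E] [InnerProductSpace ℝ E] [FiniteDimensional ℝ E]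
  {u : E → ℝ}

theorem exists_isLocalMin_add_mul_norm_sub_sq {M : ℝ} (hu : Continuous u) (hM : ∀ x, |u x| ≤ M)
    {δ : ℝ} (hδ : 0 < δ) (c : E) :
    ∃ x, δ * ‖x - c‖ ^ 2 ≤ 2 * M ∧ IsLocalMin (fun y => u y + δ * ‖y - c‖ ^ 2) x := by
  have hfar : ∀ᶠ y in cocompact E, u c + δ * ‖c - c‖ ^ 2 ≤ u y + δ * ‖y - c‖ ^ 2 := by
    have htendsto : Tendsto (fun y => δ * dist y c ^ 2) (cocompact E) atTop :=
      ((tendsto_pow_atTop two_ne_zero).comp (tendsto_dist_right_cocompact_atTop c)).const_mul_atTop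
        hδ
    filter_upwards [htendsto.eventually_ge_atTop (2 * M)] with y hy
    rw [dist_eq_norm] at hy
    rw [sub_self, norm_zero]
    linarith [abs_le.1 (hM y), abs_le.1 (hM c)]
  obtain ⟨x, hx⟩ := (by fun_prop : Continuous fun y => u y + δ * ‖y - c‖ ^ 2).exists_forall_le' c
    hfar
  refine ⟨x, ?_, Eventually.of_forall hx⟩
  have hxc := hx c
  rw [sub_self, norm_zero] at hxc
  linarith [abs_le.1 (hM x), abs_le.1 (hM c)]

theorem exists_norm_fderiv_lt_and_neg_lt_laplacian (hu : ContDiff ℝ 2 u)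
    (hbdd : ∃ M, ∀ x, |u x| ≤ M) {ε : ℝ} (hε : 0 < ε) :
    ∃ R, ∀ c, ∃ x ∈ closedBall c R, ‖fderiv ℝ u x‖ < ε ∧ -ε < Δ u x := by
  obtain ⟨M, hM⟩ := hbdd
  obtain ⟨δ, ⟨hδM, hδd⟩, hδ⟩ :
      ∃ δ : ℝ, (8 * M * δ < ε ^ 2 ∧ 2 * δ * Module.finrank ℝ E < ε) ∧ 0 < δ := by
    have hM_small : Tendsto (fun δ : ℝ => 8 * M * δ) (𝓝[>] 0) (𝓝 0) :=
      tendsto_nhdsWithin_of_tendsto_nhds (Continuous.tendsto' (by fun_prop) 0 0 (by simp))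
    have hd_small : Tendsto (fun δ : ℝ => 2 * δ * Module.finrank ℝ E) (𝓝[>] 0) (𝓝 0) :=
      tendsto_nhdsWithin_of_tendsto_nhds (Continuous.tendsto' (by fun_prop) 0 0 (by simp))
    exact (((hM_small.eventually_lt_const (pow_pos hε 2)).and
      (hd_small.eventually_lt_const hε)).and self_mem_nhdsWithin).exists
  refine ⟨√(2 * M / δ), fun c => ?_⟩
  obtain ⟨x, hxM, hmin⟩ := exists_isLocalMin_add_mul_norm_sub_sq hu.continuous hM hδ c
  refine ⟨x, ?_, ?_, ?_⟩
  · rw [mem_closedBall_iff_norm]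
    exact Real.le_sqrt_of_sq_le ((le_div_iff₀' hδ).2 hxM)
  · have hcrit := hmin.hasFDerivAt_eq_zero
      ((hu.differentiable (by simp) x).hasFDerivAt.add (hasFDerivAt_const_mul_norm_sub_sq δ c x))
    have hnorm : ‖fderiv ℝ u x‖ = 2 * δ * ‖x - c‖ := by
      rw [eq_neg_of_add_eq_zero_left hcrit, norm_neg, norm_smul, innerSL_apply_norm,
        Real.norm_of_nonneg (by positivity)]
    rw [hnorm]
    exact lt_of_pow_lt_pow_left₀ 2 hε.le (by nlinarith)
  · have hquad : ContDiff ℝ 2 fun y => δ * ‖y - c‖ ^ 2 := contDiff_const_mul_norm_sub_sq δ c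
    have hlap : 0 ≤ Δ (u + fun y => δ * ‖y - c‖ ^ 2) x :=
      laplacian_nonneg_of_isLocalMin hmin (hu.add hquad).contDiffAt
    rw [hu.contDiffAt.laplacian_add hquad.contDiffAt, laplacian_const_mul_norm_sub_sq] at hlap
    linarith

end BoundedFunctions

section Gradient

variable {E : Type*} [NormedAddCommGroup E] [InnerProductSpace ℝ E] [CompleteSpace E] {u : E → ℝ}

theorem norm_fderiv_eq_norm_gradient (u : E → ℝ) (x : E) : ‖fderiv ℝ u x‖ = ‖∇ u x‖ := by
  rw [← toDual_gradient, LinearIsometryEquiv.norm_map]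

theorem gradient_neg (u : E → ℝ) (x : E) : ∇ (-u) x = -∇ u x := by
  simp [gradient, fderiv_neg]

theorem exists_forall_eq_of_gradient_eq_zero (hu : Differentiable ℝ u) (h : ∀ x, ∇ u x = 0) :
    ∃ k, ∀ x, u x = k :=
  ⟨u 0, fun x => is_const_of_fderiv_eq_zero hu
    (fun y => by rw [← norm_eq_zero, norm_fderiv_eq_norm_gradient, h, norm_zero]) x 0⟩

theorem uniformContinuous_of_norm_gradient_le (hu : Differentiable ℝ u)
    (hbdd : ∃ C, ∀ x, ‖∇ u x‖ ≤ C) : UniformContinuous u := by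
  obtain ⟨C, hC⟩ := hbdd
  refine (lipschitzWith_of_nnnorm_fderiv_le (C := C.toNNReal) hu fun x => ?_).uniformContinuous
  rw [← NNReal.coe_le_coe, coe_nnnorm, norm_fderiv_eq_norm_gradient]
  exact (hC x).trans (Real.le_coe_toNNReal C)

end Gradient

section LaplacianOfGradient

variable {E : Type*} [NormedAddCommGroup E] [InnerProductSpace ℝ E] [FiniteDimensional ℝ E]
  {u : E → ℝ} {G : ℝ → ℝ}

theorem nonneg_of_laplacian_eq_norm_gradient_sq (hu : ContDiff ℝ 2 u)
    (hbdd : ∃ M, ∀ x, |u x| ≤ M) (hG : ContinuousAt G 0) (h : ∀ x, Δ u x = G (‖∇ u x‖ ^ 2)) :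
    0 ≤ G 0 := by
  have hpoint (k : ℕ) : ∃ x, ‖∇ u x‖ < 1 / (k + 1 : ℝ) ∧ -(1 / (k + 1 : ℝ)) < Δ u x := by
    obtain ⟨R, hR⟩ := exists_norm_fderiv_lt_and_neg_lt_laplacian hu hbdd
      (Nat.one_div_pos_of_nat (α := ℝ) (n := k))
    obtain ⟨x, -, hx⟩ := hR 0
    exact ⟨x, norm_fderiv_eq_norm_gradient u x ▸ hx⟩
  choose x hgrad hlap using hpoint
  have hinv : Tendsto (fun k : ℕ => 1 / (k + 1 : ℝ)) atTop (𝓝 0) :=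
    tendsto_one_div_add_atTop_nhds_zero_nat
  have hgrad_lim : Tendsto (fun k => ‖∇ u (x k)‖ ^ 2) atTop (𝓝 0) := by
    simpa using (squeeze_zero (fun _ => norm_nonneg _) (fun k => (hgrad k).le) hinv).pow 2
  have hinv_neg : Tendsto (fun k : ℕ => -(1 / (k + 1 : ℝ))) atTop (𝓝 0) := by
    simpa only [neg_zero] using hinv.neg
  exact le_of_tendsto_of_tendsto' hinv_neg (hG.tendsto.comp hgrad_lim) fun k =>
    (hlap k).le.trans_eq (h (x k))

theorem eq_zero_of_laplacian_eq_norm_gradient_sq (hu : ContDiff ℝ 2 u)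
    (hbdd : ∃ M, ∀ x, |u x| ≤ M) (hG : ContinuousAt G 0) (h : ∀ x, Δ u x = G (‖∇ u x‖ ^ 2)) :
    G 0 = 0 := by
  refine le_antisymm ?_ (nonneg_of_laplacian_eq_norm_gradient_sq hu hbdd hG h)
  refine neg_nonneg.1 (nonneg_of_laplacian_eq_norm_gradient_sq (u := -u) (G := -G) hu.neg
    (by simpa using hbdd) hG.neg fun x => ?_)
  rw [InnerProductSpace.laplacian_neg, gradient_neg, norm_neg, Pi.neg_apply, Pi.neg_apply, h]

end LaplacianOfGradient

section MonotoneNonlinearity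

theorem monotoneOn_range_of_deriv_nonneg {X : Type*} [TopologicalSpace X] [PreconnectedSpace X]
    {f : ℝ → ℝ} {u : X → ℝ} (hf : Differentiable ℝ f) (hu : Continuous u)
    (h : ∀ x, 0 ≤ deriv f (u x)) : MonotoneOn f (range u) := by
  refine monotoneOn_of_deriv_nonneg (isPreconnected_range hu).ordConnected.convex
    hf.continuous.continuousOn hf.differentiableOn fun t ht => ?_
  obtain ⟨x, rfl⟩ := interior_subset ht
  exact h x

variable {n : ℕ}

/-- The operator `-Δ`, to which the propagation of near-maxima is applied in the semilinear case. -/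
noncomputable def LinearOperator2.negLaplacian (n : ℕ) : LinearOperator2 n where
  a _ := 1
  b _ := 0
  c _ := 0

theorem LinearOperator2.generator_negLaplacian {w : RSpace n → ℝ} {x : RSpace n}
    (hw : ContDiffAt ℝ 2 w x) : (negLaplacian n).generator w x = Δ w x := by
  simp [generator, negLaplacian, Matrix.one_apply, laplacian_eq_sum_hessianMatrix hw]

theorem LinearOperator2.isUniformlyEllipticOn_negLaplacian (S : Set (RSpace n)) :
    (negLaplacian n).IsUniformlyEllipticOn S := by
  refine ⟨1, fun x _ => ⟨1, one_pos, fun ξ => ?_, by simp [negLaplacian]⟩⟩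
  have hform : (negLaplacian n).principalForm x ξ = ‖ξ‖ ^ 2 := by
    simp [principalForm, negLaplacian, Matrix.one_apply, EuclideanSpace.real_norm_sq_eq, ← pow_two]
  simp [hform]

variable {u : RSpace n → ℝ} {f : ℝ → ℝ}

theorem apply_add_le_of_laplacian_eq (hu : ContDiff ℝ 2 u) (hbdd : ∃ M, ∀ x, |u x| ≤ M)
    (hcont : UniformContinuous u) (hf : MonotoneOn f (range u)) (h : ∀ x, Δ u x = f (u x))
    (e x : RSpace n) : u (x + e) ≤ u x := by
  obtain ⟨M, hM⟩ := hbdd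
  have hshift : ContDiff ℝ 2 fun y => u (y + e) := hu.comp (contDiff_id.add contDiff_const)
  set w : RSpace n → ℝ := (fun y => u (y + e)) - u
  have hw : ContDiff ℝ 2 w := hshift.sub hu
  have hw_cont : UniformContinuous w :=
    (hcont.comp (uniformContinuous_id.add uniformContinuous_const)).sub hcont
  have hw_sub (y : RSpace n) (hy : 0 < w y) :
      0 ≤ (LinearOperator2.negLaplacian n).generator w y := by
    rw [LinearOperator2.generator_negLaplacian hw.contDiffAt,
      hshift.contDiffAt.laplacian_sub hu.contDiffAt, laplacian_comp_add_right, h, h, sub_nonneg]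
    exact hf (mem_range_self y) (mem_range_self (y + e)) (sub_pos.1 hy).le
  have hw_bdd : BddAbove (range w) := by
    refine ⟨2 * M, forall_mem_range.2 fun y => ?_⟩
    linarith [abs_le.1 (hM y), abs_le.1 (hM (y + e)), show w y = u (y + e) - u y from rfl]
  by_contra! hlt
  set S := ⨆ y, w y
  have hS : 0 < S := (sub_pos.2 hlt).trans_le (le_ciSup hw_bdd x)
  obtain ⟨N, hN⟩ := exists_nat_gt (2 * M / (S / 2))
  obtain ⟨z, hz⟩ :=
    (LinearOperator2.isUniformlyEllipticOn_negLaplacian _).exists_forall_mem_closedBall_sub_lt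
      hw_cont (isLUB_ciSup hw_bdd) hS (fun _ _ => hw.contDiffAt) hw_sub (N * ‖e‖) (half_pos hS)
  have hstep (j : ℕ) (hj : j ∈ Finset.range N) : S / 2 ≤ u (z + (j + 1) • e) - u (z + j • e) := by
    have hmem : z + j • e ∈ closedBall z (N * ‖e‖) := by
      rw [mem_closedBall_iff_norm, add_sub_cancel_left]
      exact (norm_nsmul_le ..).trans (by gcongr; exact (Finset.mem_range.1 hj).le)
    rw [succ_nsmul, ← add_assoc]
    exact ((sub_half S).symm.trans_lt (hz _ hmem)).le
  have hsum : N * (S / 2) ≤ u (z + N • e) - u z := by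
    simpa [Finset.sum_range_sub fun j => u (z + j • e)] using Finset.card_nsmul_le_sum _ _ _ hstep
  rw [div_lt_iff₀ (half_pos hS)] at hN
  linarith [abs_le.1 (hM z), abs_le.1 (hM (z + N • e))]

theorem exists_forall_eq_of_laplacian_eq (hu : ContDiff ℝ 2 u) (hbdd : ∃ M, ∀ x, |u x| ≤ M)
    (hcont : UniformContinuous u) (hf : MonotoneOn f (range u)) (h : ∀ x, Δ u x = f (u x)) :
    ∃ k, ∀ x, u x = k := by
  have hle := apply_add_le_of_laplacian_eq hu hbdd hcont hf h
  exact ⟨u 0, fun x => le_antisymm (by simpa using hle x 0) (by simpa using hle (-x) x)⟩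

end MonotoneNonlinearity

section PFunction

variable {n : ℕ} {u : RSpace n → ℝ} {P : ℝ → RSpace n → ℝ} {m : RSpace n → ℝ}

theorem IsPFunction.exists_generator_nonneg (hP : IsPFunction u P m)
    (hm : ∀ x, ∇ u x ≠ 0 → 0 < m x) {θ ε : ℝ} (hθ : 0 ≤ θ) (hε : 0 < ε)
    (hgrad : ∀ x, θ < P (u x) (∇ u x) → ε ≤ ‖∇ u x‖) :
    ∃ L : LinearOperator2 n, L.IsUniformlyEllipticOn {x | θ < P (u x) (∇ u x)} ∧
      ∀ x, θ < P (u x) (∇ u x) → ContDiffAt ℝ 2 (fun y => P (u y) (∇ u y)) x ∧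
        0 ≤ L.generator (fun y => P (u y) (∇ u y)) x := by
  obtain ⟨-, hsmooth, L, hc, -, helliptic, hL⟩ := hP
  refine ⟨L, (helliptic ε hε).mono hgrad, fun x hx => ?_⟩
  have hmx : 0 < m x := hm x (norm_pos_iff.1 (hε.trans_le (hgrad x hx)))
  exact ⟨hsmooth x hmx, LinearOperator2.generator_nonneg (hc x) (hθ.trans hx.le)
    (nonpos_of_mul_nonpos_right (hL x) hmx)⟩

theorem IsPFunction.apply_nonpos (hP : IsPFunction u P m) (hu : ContDiff ℝ 2 u)
    (hbdd : ∃ M, ∀ x, |u x| ≤ M) (hgrad_bdd : ∃ C, ∀ x, ‖∇ u x‖ ≤ C)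
    (hgrad_cont : UniformContinuous (∇ u)) (hP_cont : Continuous fun q : ℝ × RSpace n => P q.1 q.2)
    (hP_zero : ∀ s, P s 0 ≤ 0) (hm : ∀ x, ∇ u x ≠ 0 → 0 < m x) (x : RSpace n) :
    P (u x) (∇ u x) ≤ 0 := by
  have hu_cont : UniformContinuous u :=
    uniformContinuous_of_norm_gradient_le (hu.differentiable (by simp)) hgrad_bdd
  obtain ⟨M, hM⟩ := id hbdd
  obtain ⟨C, hC⟩ := hgrad_bdd
  set K : Set (ℝ × RSpace n) := Icc (-M) M ×ˢ closedBall 0 C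
  have hK : IsCompact K := isCompact_Icc.prod (isCompact_closedBall 0 C)
  have hmem (y : RSpace n) : (u y, ∇ u y) ∈ K := ⟨abs_le.1 (hM y), by simpa using hC y⟩
  have hmem_zero (y : RSpace n) : (u y, (0 : RSpace n)) ∈ K :=
    ⟨abs_le.1 (hM y), mem_closedBall_self ((norm_nonneg _).trans (hC y))⟩
  have hPK := hK.uniformContinuousOn_of_continuous hP_cont.continuousOn
  set w : RSpace n → ℝ := fun y => P (u y) (∇ u y)
  have hw_cont : UniformContinuous w := uniformContinuousOn_univ.1 <|
    hPK.comp (hu_cont.prodMk hgrad_cont).uniformContinuousOn fun y _ => hmem y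
  have hw_bdd : BddAbove (range w) := (hK.bddAbove_image hP_cont.continuousOn).mono <| by
    rintro _ ⟨y, rfl⟩
    exact mem_image_of_mem _ (hmem y)
  by_contra! hpos
  set S := ⨆ y, w y
  have hS : 0 < S := hpos.trans_le (le_ciSup hw_bdd x)
  obtain ⟨ε, hε, hPε⟩ := Metric.uniformContinuousOn_iff.1 hPK (S / 2) (half_pos hS)
  have hsmall (y : RSpace n) (hy : ‖∇ u y‖ < ε) : w y < S / 2 := by
    have hdist := hPε _ (hmem y) _ (hmem_zero y) (by simpa [Prod.dist_eq, hε] using hy)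
    rw [Real.dist_eq] at hdist
    linarith [le_abs_self (w y - P (u y) 0), hP_zero (u y)]
  obtain ⟨L, hL, hw⟩ := hP.exists_generator_nonneg hm (half_pos hS).le hε
    fun y hy => not_lt.1 fun h => (hsmall y h).not_gt hy
  obtain ⟨R, hR⟩ := exists_norm_fderiv_lt_and_neg_lt_laplacian hu hbdd hε
  obtain ⟨z, hz⟩ := hL.exists_forall_mem_closedBall_sub_lt hw_cont (isLUB_ciSup hw_bdd)
    (half_lt_self hS) (fun y hy => (hw y hy).1) (fun y hy => (hw y hy).2) R (half_pos hS)
  obtain ⟨y, hy, hgrad, -⟩ := hR z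
  rw [norm_fderiv_eq_norm_gradient] at hgrad
  linarith [hz y hy, hsmall y hgrad]

theorem IsPFunction.exists_forall_eq (hP : IsPFunction u P m) (hu : ContDiff ℝ 2 u)
    (hbdd : ∃ M, ∀ x, |u x| ≤ M) (hgrad_bdd : ∃ C, ∀ x, ‖∇ u x‖ ≤ C)
    (hgrad_cont : UniformContinuous (∇ u)) (hP_cont : Continuous fun q : ℝ × RSpace n => P q.1 q.2)
    (hP_zero : ∀ s p, P s p ≤ 0 ↔ p = 0) (hm : ∀ x, ∇ u x ≠ 0 → 0 < m x) :
    ∃ k, ∀ x, u x = k :=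
  exists_forall_eq_of_gradient_eq_zero (hu.differentiable (by simp)) fun x =>
    (hP_zero _ _).1 <| hP.apply_nonpos hu hbdd hgrad_bdd hgrad_cont hP_cont
      (fun s => (hP_zero s 0).2 rfl) hm x

end PFunction

theorem StandingAssumption.uniformContinuous {n : ℕ} {u : RSpace n → ℝ}
    (hu : StandingAssumption u) : UniformContinuous u :=
  uniformContinuous_of_norm_gradient_le (hu.contDiff.differentiable (by simp))
    (hu.bounded_gradient.imp fun _ h => h.2)

theorem StandingAssumption.uniformContinuous_gradient {n : ℕ} {u : RSpace n → ℝ}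
    (hu : StandingAssumption u) : UniformContinuous (∇ u) := by
  obtain ⟨α, hα, -, K, hholder⟩ := hu.holder_gradient
  exact hholder.uniformContinuous hα

theorem mainTheorem7_general (n : ℕ) (u : RSpace n → ℝ) (hu : ContDiff ℝ 2 u)
    (hbdd : ∃ M, ∀ x, |u x| ≤ M) :
    (∀ (P : ℝ → RSpace n → ℝ) (m : RSpace n → ℝ),
      UniformContinuous (∇ u) → (∃ C, ∀ x, ‖∇ u x‖ ≤ C) →
      Continuous (fun q : ℝ × RSpace n => P q.1 q.2) → (∀ s p, P s p ≤ 0 ↔ p = 0) →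
      (∀ x, ∇ u x ≠ 0 → 0 < m x) → IsPFunction u P m → ∃ k, ∀ x, u x = k) ∧
    (∀ f : ℝ → ℝ, UniformContinuous u → MonotoneOn f (range u) → (∀ x, Δ u x = f (u x)) →
      ∃ k, ∀ x, u x = k) ∧
    (∀ G : ℝ → ℝ, ContinuousAt G 0 → (∀ x, Δ u x = G (‖∇ u x‖ ^ 2)) → G 0 = 0) :=
  ⟨fun _ _ hgrad_cont hgrad_bdd hP_cont hP_zero hm hP =>
      hP.exists_forall_eq hu hbdd hgrad_bdd hgrad_cont hP_cont hP_zero hm,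
    fun _ => exists_forall_eq_of_laplacian_eq hu hbdd,
    fun _ => eq_zero_of_laplacian_eq_norm_gradient_sq hu hbdd⟩

theorem mainTheorem7 (n : ℕ) :
    (∀ (F : ℝ × RSpace n × Matrix (Fin n) (Fin n) ℝ → ℝ) (u : RSpace n → ℝ)
        (g : RSpace n → ℝ) (μ : ℝ → ℝ),
      Continuous F → IsEntireSolution F u → StandingAssumption u →
      Continuous g → (∀ p, 0 ≤ g p) → {p | g p = 0} = {0} →
      (∀ t : ℝ, 0 < t → 0 < μ t) →
      IsPFunction u (fun _ p => g p) (fun x => μ ‖∇ u x‖) →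
      ∃ k : ℝ, ∀ x, u x = k) ∧
    (∀ (f : ℝ → ℝ) (u : RSpace n → ℝ),
      Differentiable ℝ f → StandingAssumption u →
      (∀ x, Δ u x = f (u x)) → (∀ x, 0 ≤ deriv f (u x)) →
      ∃ k : ℝ, ∀ x, u x = k) ∧
    (∀ G : ℝ → ℝ, Continuous G → G 0 ≠ 0 →
      ¬ ∃ u : RSpace n → ℝ, StandingAssumption u ∧ ∀ x, Δ u x = G (‖∇ u x‖ ^ 2)) := by
  refine ⟨fun F u g μ _ _ hu hg hg_nonneg hg_zero hμ => ?_, fun f u hf hu hΔ hf' => ?_,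
    fun G hG hG0 ⟨u, hu, hΔ⟩ => ?_⟩
  · have hg_nonpos (p : RSpace n) : g p ≤ 0 ↔ p = 0 :=
      (hg_nonneg p).ge_iff_eq'.trans (Set.ext_iff.1 hg_zero p)
    exact (mainTheorem7_general n u hu.contDiff hu.bounded).1 _ _ hu.uniformContinuous_gradient
      (hu.bounded_gradient.imp fun _ h => h.2) (hg.comp continuous_snd) (fun _ => hg_nonpos)
      fun x hx => hμ _ (norm_pos_iff.2 hx)
  · exact (mainTheorem7_general n u hu.contDiff hu.bounded).2.1 f hu.uniformContinuous
      (monotoneOn_range_of_deriv_nonneg hf hu.contDiff.continuous hf') hΔ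
  · exact hG0 ((mainTheorem7_general n u hu.contDiff hu.bounded).2.2 G hG.continuousAt hΔ)
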